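/- Let $S_d$ be the set of permutations of $\{1,\dots,d\}$, and for $A\in\mathbb{R}^{d\times d}$ and $\pi\in S_d$ let $A^\pi$ be the matrix with entries $(A^\pi)_{ij}=A_{\pi(i),\pi(j)}$. Write $\langle A,B\rangle=\mathrm{Tr}(AB^\top)$, $\|A\|_F=\sqrt{\langle A,A\rangle}$, and let $\|A\|_{op}$ be the operator norm induced by the Euclidean norm. There is an absolute constant $C>0$ such that the following holds for all $d,m,n$ and all $\delta\in(0,1)$ with $$m\wedge n\ \ge\ d\log d+\log(1/\delta).$$ Let $\Sigma\in\mathbb{R}^{d\times d}$ be symmetric positive definite with $\|\Sigma\|_{op}\le 1$, let $\pi^\star\in S_d$, and let $X_1,\dots,X_m\sim\mathcal N(0,\Sigma)$ and $Y_1,\dots,Y_n\sim\mathcal N(0,\Sigma^{\pi^\star})$ be independent random vectors, with sample covariance matrices $\widehat\Sigma_X=\frac1m\sum_{i=1}^m X_iX_i^\top$ and $\widehat\Sigma_Y=\frac1n\sum_{i=1}^n Y_iY_i^\top$. Then, with probability at least $1-\delta$, the Gromov--Wasserstein estimator $\widehat\pi^{\mathsf{GW}}\in\operatorname{argmax}_{\pi\in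 S_d}\langle\widehat\Sigma_X^{\pi},\widehat\Sigma_Y\rangle$ (every maximizer, if there are several) satisfies $$\big\|\Sigma^{\widehat\pi^{\mathsf{GW}}}-\Sigma^{\pi^\star}\big\|_F^2\ \le\ C\left(\frac{d\log d+\log(1/\delta)}{m\wedge n}+\sqrt{\frac{d\,(d\log d+\log(1/\delta))\,(d+\log(1/\delta))}{mn}}\right).$$ -/

import Mathlib

open MeasureTheory ProbabilityTheory
-- on matrices, `‖A‖` is the Frobenius norm
open scoped Matrix.Norms.Frobenius

noncomputable section

namespace CovarianceAlignment

/-- The matrix `A^π` with entries `(A^π) i j = A (π i) (π j)`. -/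
def permute {d : ℕ} (A : Matrix (Fin d) (Fin d) ℝ) (π : Equiv.Perm (Fin d)) :
    Matrix (Fin d) (Fin d) ℝ :=
  A.submatrix π π

/-- The matrix inner product `⟨A, B⟩ = Tr (A Bᵀ)`. -/
def matInner {d : ℕ} (A B : Matrix (Fin d) (Fin d) ℝ) : ℝ :=
  (A * B.transpose).trace

/-- The operator norm `max_{‖v‖₂ = 1} ‖A v‖₂`. -/
def opNorm {d : ℕ} (A : Matrix (Fin d) (Fin d) ℝ) : ℝ :=
  ‖Matrix.toEuclideanCLM (𝕜 := ℝ) (n := Fin d) A‖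

/-- The features-by-observations matrix `[x₁, …, x_k]`, with the observations as columns. -/
def dataMatrix {d k : ℕ} (x : Fin k → EuclideanSpace ℝ (Fin d)) : Matrix (Fin d) (Fin k) ℝ :=
  Matrix.of fun i j => x j i

/-- The sample covariance matrix `[x₁, …, x_k] [x₁, …, x_k]ᵀ / k` (of centered data). -/
def sampleCov {d k : ℕ} (x : Fin k → EuclideanSpace ℝ (Fin d)) : Matrix (Fin d) (Fin d) ℝ :=
  (k : ℝ)⁻¹ • (dataMatrix x * (dataMatrix x).transpose)

/-- The joint law of the data `(X₁, …, X_m, Y₁, …, Y_n)` in the covariance alignment model: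
`X₁, …, X_m` are i.i.d. `N(0, S)`, `Y₁, …, Y_n` are i.i.d. `N(0, S^π)`, and the two samples are
independent. -/
def dataLaw {d : ℕ} (m n : ℕ) (S : Matrix (Fin d) (Fin d) ℝ) (π : Equiv.Perm (Fin d)) :
    Measure ((Fin m → EuclideanSpace ℝ (Fin d)) × (Fin n → EuclideanSpace ℝ (Fin d))) :=
  (Measure.pi fun _ : Fin m => multivariateGaussian 0 S).prod
    (Measure.pi fun _ : Fin n => multivariateGaussian 0 (permute S π))

/-- `π` is a value of the Gromov–Wasserstein estimator on the data `(x, y)`: it maximizes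
`⟨(sampleCov x)^σ, sampleCov y⟩` over all permutations `σ`. -/
def IsGWEstimate {d m n : ℕ} (x : Fin m → EuclideanSpace ℝ (Fin d))
    (y : Fin n → EuclideanSpace ℝ (Fin d)) (π : Equiv.Perm (Fin d)) : Prop :=
  ∀ σ : Equiv.Perm (Fin d),
    matInner (permute (sampleCov x) σ) (sampleCov y) ≤
      matInner (permute (sampleCov x) π) (sampleCov y)

/-- The quantity `d log d + log (1/δ)`. -/
def logTerm (d : ℕ) (δ : ℝ) : ℝ :=
  (d : ℝ) * Real.log (d : ℝ) + Real.log (1 / δ)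

/-- The rate
`(d log d + log (1/δ)) / (m ∧ n) + √(d (d log d + log (1/δ)) (d + log (1/δ)) / (m n))`. -/
def rate (d m n : ℕ) (δ : ℝ) : ℝ :=
  logTerm d δ / ((min m n : ℕ) : ℝ) +
    Real.sqrt ((d : ℝ) * logTerm d δ * ((d : ℝ) + Real.log (1 / δ)) / ((m : ℝ) * (n : ℝ)))

end CovarianceAlignment

end

/-! Write Ŝ_X, Ŝ_Y for the sample covariances, π for an estimate, σ for the truth and a = ‖S^π -
S^σ‖. Optimality of π against σ gives `IsGWEstimate.norm_sq_le`: a²/2 is at most a term linear in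
Ŝ_X - S plus the cross term ⟨Ŝ_X^π - Ŝ_X^σ, Ŝ_Y - S^σ⟩. Both are linear functionals of a sample
covariance error, once X is frozen in the second (Fubini). A Chernoff bound, resting on the
exponential moment of a Gaussian quadratic form, bounds such a functional by ‖M‖√(t/k) up to a
constant, for sample size k. A union bound over d! permutations costs d log d in t. The first test
matrix has norm a. The second has norm at most a + 2e with e = ‖Ŝ_X - S‖, and e ≤ √d · opNorm (Ŝ_X -
S) is controlled by the same inequality on a net of the ball. The terms linear in a are absorbed
into a²/2, which leaves the parametric rate; the product of e with the fluctuation of Ŝ_Y leaves the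
square-root term. -/

namespace CovarianceAlignment

/-! ### Exponential moments of the square of a standard Gaussian. -/

section ExpSq

lemma gaussian_exp_sq_eq (b x : ℝ) :
    gaussianPDFReal 0 1 x * Real.exp (b * x ^ 2) =
      (√(2 * Real.pi))⁻¹ * Real.exp (-(1 / 2 - b) * x ^ 2) := by
  rw [gaussianPDFReal_def]
  simp only [NNReal.coe_one, mul_one, sub_zero]
  rw [mul_assoc, ← Real.exp_add]
  congr 2
  ring

lemma integrable_exp_sq_gaussianReal {b : ℝ} (hb : b < 1 / 2) :
    Integrable (fun x ↦ Real.exp (b * x ^ 2)) (gaussianReal 0 1) := by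
  rw [gaussianReal_of_var_ne_zero _ one_ne_zero,
    integrable_withDensity_iff (measurable_gaussianPDF _ _) (by simp [gaussianPDF])]
  have h := (integrable_exp_neg_mul_sq (b := 1 / 2 - b) (by linarith)).const_mul
    (√(2 * Real.pi))⁻¹
  refine h.congr (ae_of_all _ fun x ↦ ?_)
  simp only [toReal_gaussianPDF]
  rw [mul_comm (Real.exp (b * x ^ 2)), gaussian_exp_sq_eq]

lemma integral_exp_sq_gaussianReal (b : ℝ) :
    ∫ x, Real.exp (b * x ^ 2) ∂(gaussianReal 0 1) = (√(1 - 2 * b))⁻¹ := by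
  rw [integral_gaussianReal_eq_integral_smul one_ne_zero]
  simp only [smul_eq_mul, gaussian_exp_sq_eq]
  rw [integral_const_mul, integral_gaussian, ← Real.sqrt_inv, ← Real.sqrt_inv,
    ← Real.sqrt_mul (by positivity)]
  congr 1
  have := Real.pi_pos
  have h : 1 - 2 * b = 2 * (1 / 2 - b) := by ring
  rw [h, mul_inv, mul_inv, div_eq_mul_inv]
  field_simp

/-- This is -log(1 - u) ≤ u + u². With u = 2b and a square root it becomes the exponent b + 2b²
below. -/
lemma one_le_one_sub_mul_exp {u : ℝ} (hu : |u| ≤ 1 / 2) :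
    1 ≤ (1 - u) * Real.exp (u + u ^ 2) := by
  obtain ⟨h1, h2⟩ := abs_le.1 hu
  rcases le_total 0 u with h | h
  · have := Real.quadratic_le_exp_of_nonneg (x := u + u ^ 2) (by positivity)
    calc (1 : ℝ) ≤ (1 - u) * (1 + (u + u ^ 2) + (u + u ^ 2) ^ 2 / 2) := by
          have : 0 ≤ u ^ 2 * ((1 - u) * (1 + u) ^ 2 / 2 - u) := by
            refine mul_nonneg (sq_nonneg _) ?_
            nlinarith [mul_nonneg h (by linarith : (0 : ℝ) ≤ 1 / 2 - u)]
          linarith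
      _ ≤ _ := by gcongr; linarith
  · have := Real.add_one_le_exp (u + u ^ 2)
    calc (1 : ℝ) ≤ (1 - u) * (u + u ^ 2 + 1) := by
          have : 0 ≤ -u * u ^ 2 := mul_nonneg (by linarith) (sq_nonneg _)
          linarith
      _ ≤ _ := by gcongr; linarith

lemma integral_exp_sq_gaussianReal_le {b : ℝ} (hb : |b| ≤ 1 / 4) :
    ∫ x, Real.exp (b * x ^ 2) ∂(gaussianReal 0 1) ≤ Real.exp (b + 2 * b ^ 2) := by
  rw [integral_exp_sq_gaussianReal]
  have hb' := abs_le.1 hb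
  have h := one_le_one_sub_mul_exp (u := 2 * b) (by rw [abs_mul]; norm_num; linarith)
  have h0 : 0 < 1 - 2 * b := by linarith
  rw [inv_le_iff_one_le_mul₀ (Real.sqrt_pos.2 h0)]
  refine (one_le_sq_iff₀ (by positivity)).1 ?_
  rw [mul_pow, Real.sq_sqrt h0.le, ← Real.exp_nat_mul, mul_comm]
  rwa [show ((2 : ℕ) : ℝ) * (b + 2 * b ^ 2) = 2 * b + (2 * b) ^ 2 by push_cast; ring]

end ExpSq

/-! ### Frobenius inner product, operator norm and permutations. -/

section Frobenius

variable {d : ℕ}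

lemma matInner_eq_sum (A B : Matrix (Fin d) (Fin d) ℝ) :
    matInner A B = ∑ i, ∑ j, A i j * B i j := by
  simp [matInner, Matrix.trace, Matrix.mul_apply]

lemma norm_sq_eq_sum {m n : Type*} [Fintype m] [Fintype n] (A : Matrix m n ℝ) :
    ‖A‖ ^ 2 = ∑ i, ∑ j, A i j ^ 2 := by
  rw [Matrix.frobenius_norm_def, ← Real.sqrt_eq_rpow, Real.sq_sqrt (by positivity)]
  simp

lemma matInner_self (A : Matrix (Fin d) (Fin d) ℝ) : matInner A A = ‖A‖ ^ 2 := by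
  rw [matInner_eq_sum, norm_sq_eq_sum]
  simp [sq]

lemma matInner_comm (A B : Matrix (Fin d) (Fin d) ℝ) : matInner A B = matInner B A := by
  simp [matInner_eq_sum, mul_comm]

lemma matInner_add_left (A B C : Matrix (Fin d) (Fin d) ℝ) :
    matInner (A + B) C = matInner A C + matInner B C := by
  simp [matInner, add_mul]

lemma matInner_sub_left (A B C : Matrix (Fin d) (Fin d) ℝ) :
    matInner (A - B) C = matInner A C - matInner B C := by
  simp [matInner, sub_mul]

lemma matInner_sub_right (A B C : Matrix (Fin d) (Fin d) ℝ) :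
    matInner A (B - C) = matInner A B - matInner A C := by
  simp [matInner, mul_sub]

lemma matInner_smul_left (c : ℝ) (A B : Matrix (Fin d) (Fin d) ℝ) :
    matInner (c • A) B = c * matInner A B := by
  simp [matInner]

lemma matInner_transpose (A B : Matrix (Fin d) (Fin d) ℝ) :
    matInner A.transpose B.transpose = matInner A B := by
  rw [matInner_eq_sum, matInner_eq_sum, Finset.sum_comm]
  rfl

lemma matInner_permute (A B : Matrix (Fin d) (Fin d) ℝ) (π : Equiv.Perm (Fin d)) :
    matInner (permute A π) (permute B π) = matInner A B := by
  simp only [matInner_eq_sum, permute, Matrix.submatrix_apply]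
  rw [Equiv.sum_comp π (fun i ↦ ∑ j, A i (π j) * B i (π j))]
  exact Finset.sum_congr rfl fun i _ ↦ Equiv.sum_comp π (fun j ↦ A i j * B i j)

lemma norm_permute (A : Matrix (Fin d) (Fin d) ℝ) (π : Equiv.Perm (Fin d)) :
    ‖permute A π‖ = ‖A‖ := by
  rw [← sq_eq_sq₀ (norm_nonneg _) (norm_nonneg _), ← matInner_self, ← matInner_self,
    matInner_permute]

/-- The columns of a matrix product are the images of the columns of the second factor. -/
lemma norm_mul_le_opNorm_mul (A B : Matrix (Fin d) (Fin d) ℝ) : ‖A * B‖ ≤ opNorm A * ‖B‖ := by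
  have h0 : 0 ≤ opNorm A := norm_nonneg _
  refine (sq_le_sq₀ (norm_nonneg _) (by positivity)).1 ?_
  rw [mul_pow, norm_sq_eq_sum, norm_sq_eq_sum, Finset.sum_comm,
    Finset.sum_comm (f := fun i j ↦ B i j ^ 2), Finset.mul_sum]
  refine Finset.sum_le_sum fun j _ ↦ ?_
  have h := (Matrix.toEuclideanCLM (𝕜 := ℝ) (n := Fin d) A).le_opNorm (WithLp.toLp 2 (B.col j))
  have h2 := (sq_le_sq₀ (norm_nonneg _) (by positivity)).2 h
  rw [mul_pow, EuclideanSpace.norm_sq_eq, EuclideanSpace.norm_sq_eq] at h2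
  simpa [opNorm, Matrix.mul_apply, Matrix.mulVec, dotProduct] using h2

lemma opNorm_transpose (A : Matrix (Fin d) (Fin d) ℝ) : opNorm A.transpose = opNorm A := by
  have : A.transpose = star A := by
    rw [Matrix.star_eq_conjTranspose, Matrix.conjTranspose_eq_transpose_of_trivial]
  rw [opNorm, this, map_star]
  exact norm_star (E := EuclideanSpace ℝ (Fin d) →L[ℝ] EuclideanSpace ℝ (Fin d)) _

lemma norm_mul_le_mul_opNorm (A B : Matrix (Fin d) (Fin d) ℝ) : ‖A * B‖ ≤ ‖A‖ * opNorm B := by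
  rw [← Matrix.frobenius_norm_transpose, Matrix.transpose_mul, ← opNorm_transpose,
    ← Matrix.frobenius_norm_transpose A, mul_comm]
  exact norm_mul_le_opNorm_mul _ _

/-- The Frobenius norm is at most `√d` times the operator norm. -/
lemma norm_le_sqrt_mul_opNorm (A : Matrix (Fin d) (Fin d) ℝ) : ‖A‖ ≤ √d * opNorm A := by
  have h := norm_mul_le_opNorm_mul A 1
  have h1 : ‖(1 : Matrix (Fin d) (Fin d) ℝ)‖ = √d := by
    rw [← Real.sqrt_sq (norm_nonneg _), norm_sq_eq_sum]
    simp [Matrix.one_apply]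
  rwa [mul_one, h1, mul_comm] at h

lemma opNorm_permute_le (A : Matrix (Fin d) (Fin d) ℝ) (π : Equiv.Perm (Fin d)) :
    opNorm (permute A π) ≤ opNorm A := by
  have h0 : 0 ≤ opNorm A := norm_nonneg _
  refine ContinuousLinearMap.opNorm_le_bound _ h0 fun v ↦ ?_
  let w : EuclideanSpace ℝ (Fin d) := WithLp.toLp 2 fun i ↦ v (π.symm i)
  have hw : ‖w‖ = ‖v‖ := by
    rw [EuclideanSpace.norm_eq, EuclideanSpace.norm_eq]
    exact congrArg _ (Equiv.sum_comp π.symm fun i ↦ ‖v i‖ ^ 2)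
  have h := (Matrix.toEuclideanCLM (𝕜 := ℝ) (n := Fin d) A).le_opNorm w
  rw [hw] at h
  refine le_of_eq_of_le ?_ h
  rw [EuclideanSpace.norm_eq, EuclideanSpace.norm_eq]
  congr 1
  rw [← Equiv.sum_comp π (fun i ↦ ‖(Matrix.toEuclideanCLM (𝕜 := ℝ) (n := Fin d) A) w i‖ ^ 2)]
  refine Finset.sum_congr rfl fun i _ ↦ ?_
  congr 2
  simp only [permute, Matrix.ofLp_toEuclideanCLM, Matrix.mulVec, dotProduct, w]
  rw [← Equiv.sum_comp π (fun j ↦ A (π i) j * _)]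
  simp

end Frobenius

/-! ### Quadratic forms in an eigenbasis. -/

section QuadraticForm

variable {d : ℕ}

/-- The quadratic form `x ↦ xᵀ A x` of a matrix. -/
noncomputable def quadForm (A : Matrix (Fin d) (Fin d) ℝ) (x : EuclideanSpace ℝ (Fin d)) : ℝ :=
  inner ℝ x (Matrix.toEuclideanCLM (𝕜 := ℝ) (n := Fin d) A x)

lemma quadForm_eq_sum (A : Matrix (Fin d) (Fin d) ℝ) (x : EuclideanSpace ℝ (Fin d)) :
    quadForm A x = ∑ i, ∑ j, A i j * (x i * x j) := by
  simp only [quadForm, PiLp.inner_apply, Matrix.ofLp_toEuclideanCLM, Matrix.mulVec, dotProduct]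
  simp only [RCLike.inner_apply, conj_trivial, Finset.sum_mul]
  exact Finset.sum_congr rfl fun i _ ↦ Finset.sum_congr rfl fun j _ ↦ by ring

lemma continuous_quadForm (A : Matrix (Fin d) (Fin d) ℝ) : Continuous (quadForm A) := by
  unfold quadForm; fun_prop

variable {N : Matrix (Fin d) (Fin d) ℝ}

lemma toEuclideanCLM_eigenvectorBasis (hN : N.IsHermitian) (i : Fin d) :
    Matrix.toEuclideanCLM (𝕜 := ℝ) (n := Fin d) N (hN.eigenvectorBasis i) =
      hN.eigenvalues i • hN.eigenvectorBasis i := by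
  apply WithLp.ofLp_injective
  simpa using hN.mulVec_eigenvectorBasis i

lemma quadForm_sum_eigenvectorBasis (hN : N.IsHermitian) (x : Fin d → ℝ) :
    quadForm N (∑ i, x i • hN.eigenvectorBasis i) = ∑ i, hN.eigenvalues i * x i ^ 2 := by
  simp only [quadForm, map_sum, map_smul, toEuclideanCLM_eigenvectorBasis hN, smul_smul]
  rw [hN.eigenvectorBasis.orthonormal.inner_sum]
  exact Finset.sum_congr rfl fun i _ ↦ by simp; ring

/-- Both sides equal the sum of ‖N v‖² over the eigenbasis; Parseval is applied to each row of N. -/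
lemma sum_eigenvalues_sq (hN : N.IsHermitian) : ∑ i, hN.eigenvalues i ^ 2 = ‖N‖ ^ 2 := by
  have h1 (i : Fin d) : hN.eigenvalues i ^ 2 =
      ∑ k, (∑ j, N k j * hN.eigenvectorBasis i j) ^ 2 := by
    have h := congrArg (‖·‖ ^ 2) (toEuclideanCLM_eigenvectorBasis hN i)
    simp only [norm_smul, mul_pow, hN.eigenvectorBasis.norm_eq_one, EuclideanSpace.norm_sq_eq,
      Matrix.ofLp_toEuclideanCLM, Matrix.mulVec, dotProduct, Real.norm_eq_abs, sq_abs] at h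
    simpa using h.symm
  simp only [h1]
  rw [Finset.sum_comm, norm_sq_eq_sum]
  refine Finset.sum_congr rfl fun k _ ↦ ?_
  have h := hN.eigenvectorBasis.sum_sq_norm_inner_right (WithLp.toLp 2 (N k))
  rw [EuclideanSpace.norm_sq_eq] at h
  simpa [PiLp.inner_apply] using h

end QuadraticForm

open scoped MatrixOrder

/-! ### Exponential moments of Gaussian quadratic forms. -/

section ChaosMoment

variable {d : ℕ} {N : Matrix (Fin d) (Fin d) ℝ}

lemma continuous_exp_quadForm (M : Matrix (Fin d) (Fin d) ℝ) :
    Continuous fun x ↦ Real.exp (quadForm M x) :=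
  Real.continuous_exp.comp (continuous_quadForm M)

lemma abs_eigenvalues_le (hN : N.IsHermitian) (i : Fin d) : |hN.eigenvalues i| ≤ ‖N‖ := by
  refine abs_le_of_sq_le_sq ?_ (norm_nonneg _)
  rw [← sum_eigenvalues_sq hN]
  exact Finset.single_le_sum (f := fun i ↦ hN.eigenvalues i ^ 2)
    (fun i _ ↦ sq_nonneg _) (Finset.mem_univ i)

lemma exp_quadForm_sum_eigenvectorBasis (hN : N.IsHermitian) (x : Fin d → ℝ) :
    Real.exp (quadForm N (∑ i, x i • hN.eigenvectorBasis i)) =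
      ∏ i, Real.exp (hN.eigenvalues i * x i ^ 2) := by
  rw [quadForm_sum_eigenvectorBasis hN, Real.exp_sum]

lemma integrable_exp_quadForm_stdGaussian (hN : N.IsHermitian) (h : ‖N‖ ≤ 1 / 4) :
    Integrable (fun x ↦ Real.exp (quadForm N x)) (stdGaussian (EuclideanSpace ℝ (Fin d))) := by
  rw [stdGaussian_eq_map_pi_orthonormalBasis hN.eigenvectorBasis,
    integrable_map_measure (continuous_exp_quadForm N).aestronglyMeasurable
      (Measurable.aemeasurable (by fun_prop))]
  simp only [Function.comp_def, exp_quadForm_sum_eigenvectorBasis hN]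
  refine Integrable.fintype_prod (f := fun i (x : ℝ) ↦ Real.exp (hN.eigenvalues i * x ^ 2))
    fun i ↦ integrable_exp_sq_gaussianReal ?_
  linarith [le_abs_self (hN.eigenvalues i), abs_eigenvalues_le hN i]

/-- By rotation invariance the coordinates in the eigenbasis of N are independent standard
Gaussians, so the integral factors over the eigenvalues. -/
lemma integral_exp_quadForm_stdGaussian_le (hN : N.IsHermitian) (h : ‖N‖ ≤ 1 / 4) :
    ∫ x, Real.exp (quadForm N x) ∂(stdGaussian (EuclideanSpace ℝ (Fin d))) ≤
      Real.exp (N.trace + 2 * ‖N‖ ^ 2) := by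
  rw [stdGaussian_eq_map_pi_orthonormalBasis hN.eigenvectorBasis,
    integral_map (Measurable.aemeasurable (by fun_prop))
      (continuous_exp_quadForm N).aestronglyMeasurable]
  simp only [exp_quadForm_sum_eigenvectorBasis hN]
  rw [integral_fintype_prod_eq_prod (f := fun i (x : ℝ) ↦ Real.exp (hN.eigenvalues i * x ^ 2)),
    hN.trace_eq_sum_eigenvalues, ← sum_eigenvalues_sq hN, Finset.mul_sum]
  simp only [RCLike.ofReal_real_eq_id, id]
  rw [← Finset.sum_add_distrib, Real.exp_sum]
  refine Finset.prod_le_prod (fun i _ ↦ integral_nonneg fun x ↦ (Real.exp_pos _).le) fun i _ ↦ ?_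
  exact integral_exp_sq_gaussianReal_le ((abs_eigenvalues_le hN i).trans h)

/-- The symmetric part of a matrix. -/
noncomputable def symmPart (M : Matrix (Fin d) (Fin d) ℝ) : Matrix (Fin d) (Fin d) ℝ :=
  (1 / 2 : ℝ) • (M + M.transpose)

lemma isHermitian_symmPart (M : Matrix (Fin d) (Fin d) ℝ) : (symmPart M).IsHermitian := by
  rw [Matrix.IsHermitian, Matrix.conjTranspose_eq_transpose_of_trivial]
  simp [symmPart, add_comm]

lemma norm_symmPart_le (M : Matrix (Fin d) (Fin d) ℝ) : ‖symmPart M‖ ≤ ‖M‖ := by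
  have h := norm_add_le M M.transpose
  rw [Matrix.frobenius_norm_transpose] at h
  rw [symmPart, norm_smul]
  norm_num
  linarith

/-- Lets the spectral argument reach non-symmetric test matrices, such as the rank-one matrices used
on the net. -/
lemma quadForm_symmPart (M : Matrix (Fin d) (Fin d) ℝ) (x : EuclideanSpace ℝ (Fin d)) :
    quadForm (symmPart M) x = quadForm M x := by
  simp only [quadForm_eq_sum, symmPart, Matrix.smul_apply, Matrix.add_apply,
    Matrix.transpose_apply, smul_eq_mul, mul_add, add_mul, Finset.sum_add_distrib]
  rw [Finset.sum_comm (f := fun i j ↦ 1 / 2 * M j i * (x i * x j)), ← Finset.sum_add_distrib]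
  refine Finset.sum_congr rfl fun i _ ↦ ?_
  rw [← Finset.sum_add_distrib]
  exact Finset.sum_congr rfl fun j _ ↦ by ring

lemma matInner_symmPart (M : Matrix (Fin d) (Fin d) ℝ) {T : Matrix (Fin d) (Fin d) ℝ}
    (hT : T.IsHermitian) : matInner (symmPart M) T = matInner M T := by
  have hT' : T.transpose = T := by
    rw [← Matrix.conjTranspose_eq_transpose_of_trivial]; exact hT
  have h := matInner_transpose M T
  rw [hT'] at h
  rw [symmPart, matInner_smul_left, matInner_add_left, h]
  ring

variable {T : Matrix (Fin d) (Fin d) ℝ}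

lemma isHermitian_sqrt (T : Matrix (Fin d) (Fin d) ℝ) : (CFC.sqrt T).IsHermitian :=
  (Matrix.nonneg_iff_posSemidef.1 (CFC.sqrt_nonneg T)).1

lemma sqrt_mul_sqrt (hT : T.PosSemidef) : CFC.sqrt T * CFC.sqrt T = T :=
  CFC.sqrt_mul_sqrt_self T (Matrix.nonneg_iff_posSemidef.2 hT)

variable {M : Matrix (Fin d) (Fin d) ℝ}

lemma opNorm_sqrt_le_one (hT : T.PosSemidef) (h : opNorm T ≤ 1) : opNorm (CFC.sqrt T) ≤ 1 := by
  have hs : star (CFC.sqrt T) = CFC.sqrt T := isHermitian_sqrt T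
  have h1 : opNorm T = opNorm (CFC.sqrt T) * opNorm (CFC.sqrt T) := by
    conv_lhs => rw [← sqrt_mul_sqrt hT]
    conv_lhs => enter [1, 1]; rw [← hs]
    rw [opNorm, map_mul, map_star]
    exact CStarRing.norm_star_mul_self (E := EuclideanSpace ℝ (Fin d) →L[ℝ] EuclideanSpace ℝ (Fin d))
  have h0 : 0 ≤ opNorm (CFC.sqrt T) := norm_nonneg _
  nlinarith

lemma quadForm_sqrt (M T : Matrix (Fin d) (Fin d) ℝ) (x : EuclideanSpace ℝ (Fin d)) :
    quadForm M (Matrix.toEuclideanCLM (𝕜 := ℝ) (n := Fin d) (CFC.sqrt T) x) =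
      quadForm (CFC.sqrt T * M * CFC.sqrt T) x := by
  have hs : star (CFC.sqrt T) = CFC.sqrt T := isHermitian_sqrt T
  have h : ContinuousLinearMap.adjoint (Matrix.toEuclideanCLM (𝕜 := ℝ) (n := Fin d) (CFC.sqrt T)) =
      Matrix.toEuclideanCLM (𝕜 := ℝ) (n := Fin d) (CFC.sqrt T) := by
    rw [← ContinuousLinearMap.star_eq_adjoint, ← map_star, hs]
  rw [quadForm, ← ContinuousLinearMap.adjoint_inner_right, h, quadForm, map_mul, map_mul]
  rfl

lemma isHermitian_sqrt_mul_mul_sqrt (hM : M.IsHermitian) (T : Matrix (Fin d) (Fin d) ℝ) :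
    (CFC.sqrt T * M * CFC.sqrt T).IsHermitian := by
  have := isHermitian_sqrt T
  rw [Matrix.IsHermitian, Matrix.conjTranspose_mul, Matrix.conjTranspose_mul, this.eq, hM.eq,
    mul_assoc]

lemma norm_sqrt_mul_mul_sqrt_le (hT : T.PosSemidef) (h : opNorm T ≤ 1)
    (M : Matrix (Fin d) (Fin d) ℝ) : ‖CFC.sqrt T * M * CFC.sqrt T‖ ≤ ‖M‖ := by
  have h1 := opNorm_sqrt_le_one hT h
  calc ‖CFC.sqrt T * M * CFC.sqrt T‖ ≤ opNorm (CFC.sqrt T) * ‖M‖ * opNorm (CFC.sqrt T) :=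
        (norm_mul_le_mul_opNorm _ _).trans
          (mul_le_mul_of_nonneg_right (norm_mul_le_opNorm_mul _ _) (norm_nonneg _))
    _ ≤ 1 * ‖M‖ * 1 := by gcongr; exact norm_nonneg _
    _ = ‖M‖ := by ring

lemma trace_sqrt_mul_mul_sqrt (hT : T.PosSemidef) (M : Matrix (Fin d) (Fin d) ℝ) :
    (CFC.sqrt T * M * CFC.sqrt T).trace = matInner M T := by
  have hT' : T.transpose = T := by
    rw [← Matrix.conjTranspose_eq_transpose_of_trivial]; exact hT.1
  rw [Matrix.trace_mul_comm, ← mul_assoc, sqrt_mul_sqrt hT, Matrix.trace_mul_comm, matInner, hT']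

lemma multivariateGaussian_zero_eq_map (T : Matrix (Fin d) (Fin d) ℝ) :
    multivariateGaussian 0 T = (stdGaussian (EuclideanSpace ℝ (Fin d))).map
      (Matrix.toEuclideanCLM (𝕜 := ℝ) (n := Fin d) (CFC.sqrt T)) := by
  simp [multivariateGaussian]

lemma integrable_exp_quadForm (hT : T.PosSemidef) (hT1 : opNorm T ≤ 1) (hM : ‖M‖ ≤ 1 / 4) :
    Integrable (fun x ↦ Real.exp (quadForm M x)) (multivariateGaussian 0 T) := by
  rw [multivariateGaussian_zero_eq_map,
    integrable_map_measure (continuous_exp_quadForm M).aestronglyMeasurable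
      (Measurable.aemeasurable (by fun_prop))]
  simp only [Function.comp_def, ← quadForm_symmPart M, quadForm_sqrt]
  exact integrable_exp_quadForm_stdGaussian (isHermitian_sqrt_mul_mul_sqrt (isHermitian_symmPart M) T)
    ((norm_sqrt_mul_mul_sqrt_le hT hT1 _).trans ((norm_symmPart_le M).trans hM))

/-- The exponential moment of a Gaussian chaos of order two. -/
lemma integral_exp_quadForm_le (hT : T.PosSemidef) (hT1 : opNorm T ≤ 1) (hM : ‖M‖ ≤ 1 / 4) :
    ∫ x, Real.exp (quadForm M x) ∂(multivariateGaussian 0 T) ≤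
      Real.exp (matInner M T + 2 * ‖M‖ ^ 2) := by
  rw [multivariateGaussian_zero_eq_map,
    integral_map (Measurable.aemeasurable (by fun_prop))
      (continuous_exp_quadForm M).aestronglyMeasurable]
  simp only [← quadForm_symmPart M, quadForm_sqrt]
  have h := (norm_sqrt_mul_mul_sqrt_le hT hT1 _).trans (norm_symmPart_le M)
  refine (integral_exp_quadForm_stdGaussian_le
    (isHermitian_sqrt_mul_mul_sqrt (isHermitian_symmPart M) T) (h.trans hM)).trans ?_
  rw [trace_sqrt_mul_mul_sqrt hT, matInner_symmPart M hT.1]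
  gcongr

end ChaosMoment

/-! ### Bernstein inequality for sample covariances. -/

section Deviation

variable {d n : ℕ} {T : Matrix (Fin d) (Fin d) ℝ}

lemma matInner_sampleCov (M : Matrix (Fin d) (Fin d) ℝ)
    (y : Fin n → EuclideanSpace ℝ (Fin d)) :
    matInner M (sampleCov y) = (n : ℝ)⁻¹ * ∑ k, quadForm M (y k) := by
  rw [matInner_comm, sampleCov, matInner_smul_left, matInner_comm]
  congr 1
  simp only [matInner_eq_sum, quadForm_eq_sum, dataMatrix, Matrix.mul_apply, Matrix.of_apply,
    Matrix.transpose_apply, Finset.mul_sum]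
  rw [Finset.sum_comm]
  rw [Finset.sum_comm (s := (Finset.univ : Finset (Fin n)))]
  conv_rhs => enter [2, i]; rw [Finset.sum_comm]
  rw [Finset.sum_comm]

lemma quadForm_smul (c : ℝ) (M : Matrix (Fin d) (Fin d) ℝ) (x : EuclideanSpace ℝ (Fin d)) :
    quadForm (c • M) x = c * quadForm M x := by
  simp [quadForm, map_smul, inner_smul_right]

/-- A Bernstein inequality for linear functionals of a Gaussian sample covariance matrix. -/
lemma measureReal_lt_matInner_sampleCov_sub_le (hT : T.PosSemidef) (hT1 : opNorm T ≤ 1)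
    (M : Matrix (Fin d) (Fin d) ℝ) {t : ℝ} (ht : 0 ≤ t) (hn : 0 < n) (htn : t ≤ 9 * n) :
    (Measure.pi fun _ : Fin n ↦ multivariateGaussian 0 T).real
      {y | 15 * ‖M‖ * √(t / n) < matInner M (sampleCov y - T)} ≤ Real.exp (-t) := by
  have hn' : (0 : ℝ) < n := by exact_mod_cast hn
  -- The tilt `c` divides by ‖M‖; for M = 0 the strict inequality makes the event empty.
  rcases eq_or_ne M 0 with rfl | hM
  · have : {y : Fin n → EuclideanSpace ℝ (Fin d) |
        15 * ‖(0 : Matrix (Fin d) (Fin d) ℝ)‖ * √(t / n) <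
          matInner (0 : Matrix (Fin d) (Fin d) ℝ) (sampleCov y - T)} = ∅ := by
      ext y; simp [matInner]
    rw [this, measureReal_empty]
    exact (Real.exp_pos _).le
  have hF : 0 < ‖M‖ := norm_pos_iff.2 hM
  set q := √(t / n) with hq
  have hq0 : 0 ≤ q := Real.sqrt_nonneg _
  have hq2 : n * q ^ 2 = t := by
    rw [hq, Real.sq_sqrt (by positivity)]; field_simp
  have hq3 : q ≤ 3 := by
    rw [hq, Real.sqrt_le_left (by norm_num), div_le_iff₀ hn']; linarith
  -- The restriction t ≤ 9n gives q ≤ 3, so the tilted matrix has norm at most 1/4, as the moment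
  -- bound requires. The final exponent is (-15/12 + 2/144) t ≤ -t.
  set c := q / 12 / ‖M‖ with hc
  have hcM : ‖c • M‖ = q / 12 := by
    rw [norm_smul, hc, Real.norm_of_nonneg (by positivity)]; field_simp
  have hcM4 : ‖c • M‖ ≤ 1 / 4 := by rw [hcM]; linarith
  have hexp (y : Fin n → EuclideanSpace ℝ (Fin d)) :
      Real.exp (n * c * matInner M (sampleCov y)) = ∏ k, Real.exp (quadForm (c • M) (y k)) := by
    rw [← Real.exp_sum, matInner_sampleCov]
    simp only [quadForm_smul, ← Finset.mul_sum]
    congr 1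
    field_simp
  have hint := Integrable.fintype_prod (μ := fun _ : Fin n ↦ multivariateGaussian 0 T)
    (f := fun _ x ↦ Real.exp (quadForm (c • M) x))
    (fun _ ↦ integrable_exp_quadForm hT hT1 hcM4)
  simp only [← hexp] at hint
  have hmgf : mgf (fun y ↦ matInner M (sampleCov y))
      (Measure.pi fun _ : Fin n ↦ multivariateGaussian 0 T) (n * c) ≤
      Real.exp (n * (matInner (c • M) T + 2 * ‖c • M‖ ^ 2)) := by
    simp only [mgf, hexp]
    rw [integral_fintype_prod_eq_prod (f := fun _ x ↦ Real.exp (quadForm (c • M) x)),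
      Finset.prod_const, Finset.card_univ, Fintype.card_fin, Real.exp_nat_mul]
    exact pow_le_pow_left₀ (integral_nonneg fun x ↦ (Real.exp_pos _).le)
      (integral_exp_quadForm_le hT hT1 hcM4) n
  calc _ ≤ (Measure.pi fun _ : Fin n ↦ multivariateGaussian 0 T).real
        {y | 15 * ‖M‖ * q + matInner M T ≤ matInner M (sampleCov y)} := by
        refine measureReal_mono fun y hy ↦ ?_
        simp only [Set.mem_ofPred_eq, matInner_sub_right] at hy ⊢
        linarith
    _ ≤ _ := measure_ge_le_exp_mul_mgf _ (by positivity) hint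
    _ ≤ Real.exp (-(n * c) * (15 * ‖M‖ * q + matInner M T)) *
        Real.exp (n * (matInner (c • M) T + 2 * ‖c • M‖ ^ 2)) := by gcongr
    _ ≤ Real.exp (-t) := by
        rw [← Real.exp_add, Real.exp_le_exp, hcM, matInner_smul_left]
        have h1 : c * ‖M‖ = q / 12 := by rw [hc]; field_simp
        have h2 : -(n * c) * (15 * ‖M‖ * q + matInner M T) +
            n * (c * matInner M T + 2 * (q / 12) ^ 2) =
            -15 * (c * ‖M‖) * q * n + 2 * (n * q ^ 2) / 144 := by ring
        rw [h2, h1, hq2]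
        have h3 : -15 * (q / 12) * q * n = -(15 / 12) * (n * q ^ 2) := by ring
        rw [h3, hq2]
        linarith

end Deviation

/-! ### Nets of the unit ball and the operator norm. -/

section Net

/-- The unit ball of a finite-dimensional space has a `1/2`-net of cardinality at most `5 ^ dim`. -/
lemma exists_half_net (E : Type*) [NormedAddCommGroup E] [NormedSpace ℝ E]
    [FiniteDimensional ℝ E] :
    ∃ s : Finset E, s.card ≤ 5 ^ Module.finrank ℝ E ∧ (∀ c ∈ s, ‖c‖ ≤ 1) ∧
      ∀ v : E, ‖v‖ ≤ 1 → ∃ c ∈ s, ‖v - c‖ ≤ 1 / 2 := by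
  classical
  -- A 1-separated set of maximal size in the ball of radius 2, scaled by 1/2, is the net: a point v
  -- missed by it would let 2v be added.
  let K : Set ℕ := {k | ∃ s : Finset E, s.card = k ∧ (∀ c ∈ s, ‖c‖ ≤ 2) ∧
    ∀ c ∈ s, ∀ d ∈ s, c ≠ d → 1 ≤ ‖c - d‖}
  have hK : BddAbove K := ⟨5 ^ Module.finrank ℝ E, by
    rintro k ⟨s, rfl, h1, h2⟩
    exact Besicovitch.card_le_of_separated s h1 h2⟩
  obtain ⟨s, hs, h1, h2⟩ := Nat.sSup_mem (s := K) ⟨0, ∅, by simp⟩ hK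
  refine ⟨s.image fun c ↦ (1 / 2 : ℝ) • c,
    Finset.card_image_le.trans (Besicovitch.card_le_of_separated s h1 h2), ?_, fun v hv ↦ ?_⟩
  · intro c hc
    obtain ⟨b, hb, rfl⟩ := Finset.mem_image.1 hc
    rw [norm_smul]
    norm_num
    linarith [h1 b hb]
  · by_contra! hcon
    have hfar : ∀ c ∈ s, 1 ≤ ‖(2 : ℝ) • v - c‖ := fun c hc ↦ by
      have h := hcon _ (Finset.mem_image_of_mem _ hc)
      have h3 : (2 : ℝ) • v - c = (2 : ℝ) • (v - (1 / 2 : ℝ) • c) := by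
        rw [smul_sub, smul_smul]; norm_num
      rw [h3, norm_smul]
      norm_num
      linarith
    have hmem : (2 : ℝ) • v ∉ s := fun h ↦ by
      have := hfar _ h
      norm_num at this
    have hle : (insert ((2 : ℝ) • v) s).card ≤ sSup K := by
      refine le_csSup hK ⟨_, rfl, ?_, ?_⟩
      · intro c hc
        rcases Finset.mem_insert.1 hc with rfl | hc
        · rw [norm_smul]; norm_num; linarith
        · exact h1 c hc
      · intro c hc e he hce
        rcases Finset.mem_insert.1 hc with rfl | hc <;> rcases Finset.mem_insert.1 he with rfl | he
        · exact absurd rfl hce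
        · exact hfar e he
        · rw [norm_sub_rev]; exact hfar c hc
        · exact h2 c hc e he hce
    rw [Finset.card_insert_of_notMem hmem, hs] at hle
    omega

variable {E F : Type*} [NormedAddCommGroup E]

/-- Approximating a unit vector from the net costs at most ‖T‖/2, which is absorbed on the left. -/
lemma continuousLinearMap_norm_le_of_half_net [NormedSpace ℝ E] [NormedAddCommGroup F]
    [NormedSpace ℝ F] {s : Finset E}
    (hs : ∀ v : E, ‖v‖ ≤ 1 → ∃ c ∈ s, ‖v - c‖ ≤ 1 / 2) (T : E →L[ℝ] F) {B : ℝ} (hB : 0 ≤ B)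
    (hT : ∀ c ∈ s, ‖T c‖ ≤ B) : ‖T‖ ≤ 2 * B := by
  have h : ‖T‖ ≤ B + ‖T‖ / 2 := by
    refine T.opNorm_le_of_unit_norm (by positivity) fun v hv ↦ ?_
    obtain ⟨c, hc, hvc⟩ := hs v hv.le
    calc ‖T v‖ = ‖T c + T (v - c)‖ := by rw [← map_add]; simp
      _ ≤ ‖T c‖ + ‖T (v - c)‖ := norm_add_le _ _
      _ ≤ B + ‖T‖ * (1 / 2) := by
        gcongr
        · exact hT c hc
        · exact (T.le_opNorm _).trans (by gcongr)
      _ = B + ‖T‖ / 2 := by ring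
  linarith

lemma norm_le_of_half_net [InnerProductSpace ℝ E] {s : Finset E}
    (hs : ∀ v : E, ‖v‖ ≤ 1 → ∃ c ∈ s, ‖v - c‖ ≤ 1 / 2) (x : E) {B : ℝ}
    (hx : ∀ c ∈ s, inner ℝ c x ≤ B) : ‖x‖ ≤ 2 * B := by
  rcases eq_or_ne x 0 with rfl | hx0
  · obtain ⟨c, hc, -⟩ := hs 0 (by simp)
    simpa using hx c hc
  have hpos := norm_pos_iff.2 hx0
  obtain ⟨c, hc, hvc⟩ := hs (‖x‖⁻¹ • x) (by rw [norm_smul]; simp [hpos.ne'])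
  have h1 : inner ℝ (‖x‖⁻¹ • x) x = ‖x‖ := by
    rw [real_inner_smul_left, real_inner_self_eq_norm_sq]; field_simp
  have h2 : inner ℝ (‖x‖⁻¹ • x - c) x ≤ 1 / 2 * ‖x‖ :=
    (real_inner_le_norm _ _).trans (by gcongr)
  rw [inner_sub_left, h1] at h2
  linarith [hx c hc]

variable {d : ℕ}

lemma matInner_vecMulVec (v w : EuclideanSpace ℝ (Fin d)) (A : Matrix (Fin d) (Fin d) ℝ) :
    matInner (Matrix.vecMulVec w v) A =
      inner ℝ w (Matrix.toEuclideanCLM (𝕜 := ℝ) (n := Fin d) A v) := by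
  simp only [matInner_eq_sum, PiLp.inner_apply, Matrix.ofLp_toEuclideanCLM, Matrix.mulVec,
    dotProduct, Matrix.vecMulVec_apply, RCLike.inner_apply, conj_trivial, Finset.sum_mul]
  exact Finset.sum_congr rfl fun i _ ↦ Finset.sum_congr rfl fun j _ ↦ by ring

lemma norm_vecMulVec (v w : EuclideanSpace ℝ (Fin d)) :
    ‖(Matrix.vecMulVec w v : Matrix (Fin d) (Fin d) ℝ)‖ = ‖w‖ * ‖v‖ := by
  rw [← sq_eq_sq₀ (norm_nonneg _) (by positivity), norm_sq_eq_sum, mul_pow,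
    EuclideanSpace.norm_sq_eq, EuclideanSpace.norm_sq_eq, Finset.sum_mul_sum]
  simp [Matrix.vecMulVec_apply, mul_pow]

/-- The operator norm is controlled by the bilinear form on a net. -/
lemma opNorm_le_of_half_net {s : Finset (EuclideanSpace ℝ (Fin d))}
    (hs : ∀ v : EuclideanSpace ℝ (Fin d), ‖v‖ ≤ 1 → ∃ c ∈ s, ‖v - c‖ ≤ 1 / 2)
    (A : Matrix (Fin d) (Fin d) ℝ) {B : ℝ} (hB : 0 ≤ B)
    (hA : ∀ v ∈ s, ∀ w ∈ s, matInner (Matrix.vecMulVec w v) A ≤ B) : opNorm A ≤ 4 * B := by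
  have h := continuousLinearMap_norm_le_of_half_net hs
    (Matrix.toEuclideanCLM (𝕜 := ℝ) (n := Fin d) A) (B := 2 * B) (by positivity) fun v hv ↦
      norm_le_of_half_net hs _ fun w hw ↦ by
        rw [← matInner_vecMulVec]; exact hA v hv w hw
  rw [opNorm]
  linarith

end Net

/-! ### The basic inequality. -/

section Estimator

variable {d m n : ℕ}

lemma matInner_permute_left (A B : Matrix (Fin d) (Fin d) ℝ) (π : Equiv.Perm (Fin d)) :
    matInner (permute A π) B = matInner A (permute B π⁻¹) := by
  rw [← matInner_permute A _ π]
  congr 1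
  ext i j
  simp [permute]

lemma norm_permute_inv_sub (S T : Matrix (Fin d) (Fin d) ℝ) (π : Equiv.Perm (Fin d)) :
    ‖permute T π⁻¹ - S‖ = ‖permute S π - T‖ := by
  rw [← norm_permute _ π, norm_sub_rev]
  congr 1
  ext i j
  simp [permute]

lemma norm_permute_sub_permute_sq (S : Matrix (Fin d) (Fin d) ℝ) (π σ : Equiv.Perm (Fin d)) :
    ‖permute S π - permute S σ‖ ^ 2 = 2 * (‖S‖ ^ 2 - matInner (permute S π) (permute S σ)) := by
  rw [← matInner_self, matInner_sub_left, matInner_sub_right, matInner_sub_right, matInner_permute,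
    matInner_permute, matInner_comm (permute S σ), matInner_self]
  ring

/-- The basic inequality for the Gromov–Wasserstein estimator. -/
lemma IsGWEstimate.norm_sq_le {x : Fin m → EuclideanSpace ℝ (Fin d)}
    {y : Fin n → EuclideanSpace ℝ (Fin d)} {π : Equiv.Perm (Fin d)} (h : IsGWEstimate x y π)
    (S : Matrix (Fin d) (Fin d) ℝ) (σ : Equiv.Perm (Fin d)) :
    ‖permute S π - permute S σ‖ ^ 2 / 2 ≤
      matInner (permute (permute S σ) π⁻¹ - S) (sampleCov x - S) +
      matInner (permute (sampleCov x) π - permute (sampleCov x) σ)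
        (sampleCov y - permute S σ) := by
  -- The right side minus the left side is exactly the gap in the objective between π and σ.
  have h := h σ
  rw [norm_permute_sub_permute_sq]
  simp only [matInner_sub_left, matInner_sub_right, matInner_permute, matInner_self]
  rw [matInner_comm _ (sampleCov x), ← matInner_permute_left, matInner_comm _ S,
    ← matInner_permute_left, matInner_comm S (sampleCov x)]
  linarith

end Estimator

/-! ### Measurability and conditioning on the first sample. -/

section Probability

variable {d m n : ℕ} {S : Matrix (Fin d) (Fin d) ℝ}

instance (π : Equiv.Perm (Fin d)) : IsProbabilityMeasure (dataLaw m n S π) := by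
  unfold dataLaw; infer_instance

lemma continuous_sampleCov_apply (k : ℕ) (i j : Fin d) :
    Continuous fun x : Fin k → EuclideanSpace ℝ (Fin d) ↦ sampleCov x i j := by
  simp only [sampleCov, dataMatrix, Matrix.smul_apply, Matrix.mul_apply, Matrix.of_apply,
    Matrix.transpose_apply]
  fun_prop

lemma norm_eq_sqrt_sum (A : Matrix (Fin d) (Fin d) ℝ) : ‖A‖ = √(∑ i, ∑ j, A i j ^ 2) := by
  rw [← norm_sq_eq_sum, Real.sqrt_sq (norm_nonneg _)]

lemma continuous_norm_of_apply {X : Type*} [TopologicalSpace X]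
    {F : X → Matrix (Fin d) (Fin d) ℝ} (hF : ∀ i j, Continuous fun x ↦ F x i j) :
    Continuous fun x ↦ ‖F x‖ := by
  simp only [norm_eq_sqrt_sum]
  fun_prop

lemma continuous_matInner_of_apply {X : Type*} [TopologicalSpace X]
    {F G : X → Matrix (Fin d) (Fin d) ℝ} (hF : ∀ i j, Continuous fun x ↦ F x i j)
    (hG : ∀ i j, Continuous fun x ↦ G x i j) : Continuous fun x ↦ matInner (F x) (G x) := by
  simp only [matInner_eq_sum]
  fun_prop

lemma posSemidef_permute (hS : S.PosDef) (π : Equiv.Perm (Fin d)) :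
    (permute S π).PosSemidef := hS.posSemidef.submatrix π

lemma dataLaw_real_fst_le (π : Equiv.Perm (Fin d)) (s : Set (Fin m → EuclideanSpace ℝ (Fin d))) :
    (dataLaw m n S π).real {z | z.1 ∈ s} ≤
      (Measure.pi fun _ : Fin m ↦ multivariateGaussian 0 S).real s := by
  have : {z : (Fin m → EuclideanSpace ℝ (Fin d)) × (Fin n → EuclideanSpace ℝ (Fin d)) | z.1 ∈ s} =
      s ×ˢ Set.univ := by ext; simp
  rw [this, dataLaw, measureReal_prod_prod]
  simp

lemma measureReal_prod_le_of_forall {α β : Type*} [MeasurableSpace α] [MeasurableSpace β]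
    (μ : Measure α) [IsProbabilityMeasure μ] (ν : Measure β) [IsProbabilityMeasure ν]
    {B : Set (α × β)} (hB : MeasurableSet B) {c : ℝ} (hc : 0 ≤ c)
    (h : ∀ x, ν.real (Prod.mk x ⁻¹' B) ≤ c) : (μ.prod ν).real B ≤ c := by
  rw [measureReal_def, Measure.prod_apply hB]
  refine ENNReal.toReal_le_of_le_ofReal hc ?_
  calc ∫⁻ x, ν (Prod.mk x ⁻¹' B) ∂μ ≤ ∫⁻ _, ENNReal.ofReal c ∂μ := by
        refine lintegral_mono fun x ↦ ?_
        rw [ENNReal.le_ofReal_iff_toReal_le (measure_ne_top _ _) hc]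
        exact h x
    _ = ENNReal.ofReal c := by simp

lemma measurableSet_cross (T : Matrix (Fin d) (Fin d) ℝ) (σ π : Equiv.Perm (Fin d)) (c : ℝ) :
    MeasurableSet
      {z : (Fin m → EuclideanSpace ℝ (Fin d)) × (Fin n → EuclideanSpace ℝ (Fin d)) |
        15 * ‖permute (sampleCov z.1) π - permute (sampleCov z.1) σ‖ * c <
        matInner (permute (sampleCov z.1) π - permute (sampleCov z.1) σ)
          (sampleCov z.2 - T)} := by
  have hc1 (i j : Fin d) : Continuous
      fun z : (Fin m → EuclideanSpace ℝ (Fin d)) × (Fin n → EuclideanSpace ℝ (Fin d)) ↦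
        (permute (sampleCov z.1) π - permute (sampleCov z.1) σ) i j :=
    ((continuous_sampleCov_apply m (π i) (π j)).comp continuous_fst).sub
      ((continuous_sampleCov_apply m (σ i) (σ j)).comp continuous_fst)
  have hc2 (i j : Fin d) : Continuous
      fun z : (Fin m → EuclideanSpace ℝ (Fin d)) × (Fin n → EuclideanSpace ℝ (Fin d)) ↦
        (sampleCov z.2 - T) i j :=
    ((continuous_sampleCov_apply n i j).comp continuous_snd).sub continuous_const
  exact (isOpen_lt ((continuous_const.mul (continuous_norm_of_apply hc1)).mul continuous_const)
    (continuous_matInner_of_apply hc1 hc2)).measurableSet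

/-- Conditionally on the first sample, the second sample obeys the Bernstein inequality. -/
lemma dataLaw_real_cross_le (hS : S.PosDef) (hS1 : opNorm S ≤ 1) (σ π : Equiv.Perm (Fin d))
    {t : ℝ} (ht : 0 ≤ t) (hn : 0 < n) (htn : t ≤ 9 * n) :
    (dataLaw m n S σ).real
      {z : (Fin m → EuclideanSpace ℝ (Fin d)) × (Fin n → EuclideanSpace ℝ (Fin d)) |
        15 * ‖permute (sampleCov z.1) π - permute (sampleCov z.1) σ‖ * √(t / n) <
        matInner (permute (sampleCov z.1) π - permute (sampleCov z.1) σ)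
          (sampleCov z.2 - permute S σ)} ≤ Real.exp (-t) :=
  measureReal_prod_le_of_forall _ _ (measurableSet_cross _ σ π _) (Real.exp_pos _).le fun x ↦ by
    have h := measureReal_lt_matInner_sampleCov_sub_le (posSemidef_permute hS σ)
      ((opNorm_permute_le S σ).trans hS1)
      (permute (sampleCov x) π - permute (sampleCov x) σ) ht hn htn
    rw [Set.preimage_ofPred_eq]
    exact h

end Probability

/-! ### Numerical inequalities. -/

section Scalars

/-- The hypotheses give a² ≤ 60ar + 10800R, and 60ar ≤ a²/2 + 1800r². The factor r²/2 suits the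
later choice r² = 2L/(m ∧ n). -/
lemma sq_le_of_half_sq_le {a e p q r R : ℝ} (ha : 0 ≤ a) (hp : p ≤ r) (hq : q ≤ r)
    (h : a ^ 2 / 2 ≤ 15 * a * p + 15 * (a + 2 * e) * q) (heq : e * q ≤ 180 * R) :
    a ^ 2 ≤ 10800 * (r ^ 2 / 2 + 2 * R) := by
  have h1 : a * p ≤ a * r := by gcongr
  have h2 : a * q ≤ a * r := by gcongr
  nlinarith [sq_nonneg (a - 60 * r), sq_nonneg r]

variable {d m n : ℕ} {δ : ℝ}

lemma le_mul_log (hd : 2 ≤ d) : (d : ℝ) ≤ 3 / 2 * (d * Real.log d) := by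
  have h2 : (2 : ℝ) ≤ d := by exact_mod_cast hd
  have h := Real.log_le_log (by norm_num) h2
  have := Real.log_two_gt_d9
  nlinarith

lemma four_mul_le_logTerm (hd : 2 ≤ d) (hδ : 0 ≤ Real.log (1 / δ)) :
    4 * (d + Real.log (1 / δ)) ≤ 6 * logTerm d δ := by
  have := le_mul_log hd
  rw [logTerm]
  linarith

lemma logTerm_pos (hd : 2 ≤ d) (hδ : 0 ≤ Real.log (1 / δ)) : 0 < logTerm d δ := by
  have := le_mul_log hd
  have h2 : (2 : ℝ) ≤ d := by exact_mod_cast hd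
  rw [logTerm]
  linarith

/-- The exponential is (δ/d^d)²: one factor d^d pays for d!, the other gives the 1/4. -/
lemma factorial_mul_exp_le (hd : 2 ≤ d) (hδ0 : 0 < δ) (hδ1 : δ < 1) :
    (d.factorial : ℝ) * Real.exp (-(2 * logTerm d δ)) ≤ δ / 3 := by
  have hd0 : (0 : ℝ) < d := by exact_mod_cast (by omega : 0 < d)
  have hP : (4 : ℝ) ≤ (d : ℝ) ^ d := by
    have : 2 ^ 2 ≤ d ^ d := (Nat.pow_le_pow_left hd 2).trans (Nat.pow_le_pow_right (by omega) hd)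
    exact_mod_cast this
  have hfac : (d.factorial : ℝ) ≤ (d : ℝ) ^ d := by exact_mod_cast Nat.factorial_le_pow d
  have hexp : Real.exp (-(2 * logTerm d δ)) = (δ / (d : ℝ) ^ d) ^ 2 := by
    rw [logTerm, ← Real.log_pow, ← Real.log_mul (by positivity) (by positivity),
      ← Real.exp_log (x := (δ / (d : ℝ) ^ d) ^ 2) (by positivity), Real.log_pow,
      ← mul_neg, ← Real.log_inv]
    congr 3
    field_simp
  rw [hexp]
  calc (d.factorial : ℝ) * (δ / (d : ℝ) ^ d) ^ 2 ≤ (d : ℝ) ^ d * (δ / (d : ℝ) ^ d) ^ 2 := by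
        gcongr
    _ = δ * (δ / (d : ℝ) ^ d) := by field_simp
    _ ≤ δ * (1 / 4) := by
        gcongr
    _ ≤ δ / 3 := by linarith

/-- Here 25^d counts pairs of net points, and e⁻⁴ ≤ 1/50 beats it, leaving 2⁻ᵈ ≤ 1/4. -/
lemma pow_mul_exp_le (hd : 2 ≤ d) (hδ0 : 0 < δ) (hδ1 : δ < 1) :
    (25 : ℝ) ^ d * Real.exp (-(4 * (d + Real.log (1 / δ)))) ≤ δ / 3 := by
  have hexp : Real.exp (-(4 * (d + Real.log (1 / δ)))) = Real.exp (-4) ^ d * δ ^ 4 := by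
    rw [← Real.exp_nat_mul, ← Real.exp_log (x := δ ^ 4) (by positivity), ← Real.exp_add,
      Real.log_pow, one_div, Real.log_inv]
    congr 1
    push_cast
    ring
  have h4 : Real.exp (-4) ≤ 1 / 50 := by
    rw [Real.exp_neg, one_div, inv_le_inv₀ (Real.exp_pos _) (by norm_num)]
    have h := Real.exp_one_gt_d9
    calc (50 : ℝ) ≤ 2.7 ^ 4 := by norm_num
      _ ≤ Real.exp 1 ^ 4 := by gcongr; linarith
      _ = Real.exp 4 := by rw [← Real.exp_nat_mul]; norm_num
  rw [hexp, ← mul_assoc, ← mul_pow]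
  calc (25 * Real.exp (-4)) ^ d * δ ^ 4 ≤ (1 / 2) ^ d * δ ^ 1 := by
        have h5 : 25 * Real.exp (-4) ≤ 1 / 2 := by linarith
        have h6 : δ ^ 4 ≤ δ ^ 1 := pow_le_pow_of_le_one hδ0.le hδ1.le (by norm_num)
        gcongr
    _ ≤ (1 / 2) ^ 2 * δ ^ 1 := by
        gcongr ?_ * _
        exact pow_le_pow_of_le_one (by norm_num) (by norm_num) hd
    _ ≤ δ / 3 := by linarith

lemma rate_nonneg (hL : 0 ≤ logTerm d δ) : 0 ≤ rate d m n δ := by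
  unfold rate; positivity

/-- Combining the deviation bounds into the rate. -/
lemma sq_le_rate {a e : ℝ} (hm : 0 < m) (hn : 0 < n) (ha : 0 ≤ a) (hL : 0 ≤ logTerm d δ)
    (hδ : 0 ≤ Real.log (1 / δ))
    (he : e ≤ √d * (4 * (15 * √(4 * (d + Real.log (1 / δ)) / m))))
    (h : a ^ 2 / 2 ≤ 15 * a * √(2 * logTerm d δ / m) +
      15 * (a + 2 * e) * √(2 * logTerm d δ / n)) :
    a ^ 2 ≤ 21600 * rate d m n δ := by
  have hm' : (0 : ℝ) < m := by exact_mod_cast hm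
  have hn' : (0 : ℝ) < n := by exact_mod_cast hn
  have hmin : (0 : ℝ) < ((min m n : ℕ) : ℝ) := by exact_mod_cast lt_min hm hn
  have hminm : ((min m n : ℕ) : ℝ) ≤ m := by exact_mod_cast min_le_left m n
  have hminn : ((min m n : ℕ) : ℝ) ≤ n := by exact_mod_cast min_le_right m n
  set L := logTerm d δ
  set R := √((d : ℝ) * L * ((d : ℝ) + Real.log (1 / δ)) / ((m : ℝ) * (n : ℝ))) with hR
  have heq : e * √(2 * L / n) ≤ 180 * R := by
    calc e * √(2 * L / n)
        ≤ √d * (4 * (15 * √(4 * (d + Real.log (1 / δ)) / m))) * √(2 * L / n) := by gcongr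
      _ = 60 * (√d * √(4 * (d + Real.log (1 / δ)) / m) * √(2 * L / n)) := by ring
      _ = 60 * √(8 * ((d : ℝ) * L * ((d : ℝ) + Real.log (1 / δ)) / ((m : ℝ) * (n : ℝ)))) := by
          rw [← Real.sqrt_mul (by positivity), ← Real.sqrt_mul (by positivity)]
          congr 2
          field_simp
          ring
      _ ≤ 60 * (3 * R) := by
          rw [Real.sqrt_mul (by norm_num)]
          gcongr
          rw [Real.sqrt_le_left (by norm_num)]
          norm_num
      _ = 180 * R := by ring
  have key := sq_le_of_half_sq_le (r := √(2 * L / (min m n : ℕ))) ha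
    (Real.sqrt_le_sqrt (by gcongr)) (Real.sqrt_le_sqrt (by gcongr)) h heq
  rw [Real.sq_sqrt (by positivity)] at key
  have hq : 2 * L / ((min m n : ℕ) : ℝ) / 2 = L / ((min m n : ℕ) : ℝ) := by ring
  rw [hq] at key
  have h0 : 0 ≤ L / ((min m n : ℕ) : ℝ) := by positivity
  change _ ≤ 21600 * (L / ((min m n : ℕ) : ℝ) + R)
  linarith

end Scalars

/-! ### From deviation events to the rate. -/

section Main

variable {d m n : ℕ} {S : Matrix (Fin d) (Fin d) ℝ} {δ : ℝ}

/-- The deterministic part: the bound holds off the deviation events. -/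
lemma IsGWEstimate.norm_sq_le_rate {x : Fin m → EuclideanSpace ℝ (Fin d)}
    {y : Fin n → EuclideanSpace ℝ (Fin d)} {π : Equiv.Perm (Fin d)} (h : IsGWEstimate x y π)
    (σ : Equiv.Perm (Fin d)) (hm : 0 < m) (hn : 0 < n) (hL : 0 ≤ logTerm d δ)
    (hδ : 0 ≤ Real.log (1 / δ))
    (h1 : matInner (permute (permute S σ) π⁻¹ - S) (sampleCov x - S) ≤
      15 * ‖permute (permute S σ) π⁻¹ - S‖ * √(2 * logTerm d δ / m))
    (h2 : opNorm (sampleCov x - S) ≤ 4 * (15 * √(4 * (d + Real.log (1 / δ)) / m)))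
    (h3 : matInner (permute (sampleCov x) π - permute (sampleCov x) σ)
        (sampleCov y - permute S σ) ≤
      15 * ‖permute (sampleCov x) π - permute (sampleCov x) σ‖ * √(2 * logTerm d δ / n)) :
    ‖permute S π - permute S σ‖ ^ 2 ≤ 21600 * rate d m n δ := by
  refine sq_le_rate (e := ‖sampleCov x - S‖) hm hn (norm_nonneg _) hL hδ
    ((norm_le_sqrt_mul_opNorm _).trans (by gcongr)) ((h.norm_sq_le S σ).trans ?_)
  rw [norm_permute_inv_sub] at h1
  have hsplit : ‖permute (sampleCov x) π - permute (sampleCov x) σ‖ ≤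
      ‖permute S π - permute S σ‖ + 2 * ‖sampleCov x - S‖ := by
    have heq : permute (sampleCov x) π - permute (sampleCov x) σ =
        (permute S π - permute S σ) + (permute (sampleCov x - S) π -
          permute (sampleCov x - S) σ) := by
      ext i j; simp [permute]; ring
    rw [heq]
    refine (norm_add_le _ _).trans ?_
    have := norm_sub_le (permute (sampleCov x - S) π) (permute (sampleCov x - S) σ)
    rw [norm_permute, norm_permute] at this
    linarith
  refine add_le_add h1 (h3.trans ?_)
  gcongr

end Main

end CovarianceAlignment

theorem theorem3 :
    ∃ C : ℝ, 0 < C ∧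
      ∀ (d m n : ℕ) (δ : ℝ), 0 < δ → δ < 1 →
        CovarianceAlignment.logTerm d δ ≤ ((min m n : ℕ) : ℝ) →
        ∀ (πstar : Equiv.Perm (Fin d)) (S : Matrix (Fin d) (Fin d) ℝ),
          S.PosDef → CovarianceAlignment.opNorm S ≤ 1 →
          1 - δ ≤ (CovarianceAlignment.dataLaw m n S πstar).real
            {z | ∀ πhat : Equiv.Perm (Fin d), CovarianceAlignment.IsGWEstimate z.1 z.2 πhat →
              ‖CovarianceAlignment.permute S πhat - CovarianceAlignment.permute S πstar‖ ^ 2 ≤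
                C * CovarianceAlignment.rate d m n δ} := by
  open CovarianceAlignment in
  refine ⟨21600, by norm_num, fun d m n δ hδ0 hδ1 hmn σ S hS hS1 ↦ ?_⟩
  have hℓ : 0 ≤ Real.log (1 / δ) := Real.log_nonneg (by rw [one_le_div hδ0]; exact hδ1.le)
  set G := {z : (Fin m → EuclideanSpace ℝ (Fin d)) × (Fin n → EuclideanSpace ℝ (Fin d)) |
    ∀ πhat : Equiv.Perm (Fin d), IsGWEstimate z.1 z.2 πhat →
      ‖permute S πhat - permute S σ‖ ^ 2 ≤ 21600 * rate d m n δ} with hG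
  set μ := dataLaw m n S σ
  -- For d ≤ 1 there is only one permutation, and d log d no longer dominates d.
  rcases Nat.lt_or_ge d 2 with hd | hd
  · have hsub : Subsingleton (Fin d) := by
      interval_cases d <;> infer_instance
    have hL : 0 ≤ logTerm d δ := by
      interval_cases d <;> simpa [logTerm] using hℓ
    have : G = Set.univ := by
      refine Set.eq_univ_of_forall fun z π _ ↦ ?_
      rw [Subsingleton.elim π σ, sub_self, norm_zero, zero_pow two_ne_zero]
      have := rate_nonneg (m := m) (n := n) hL
      positivity
    rw [this, probReal_univ]
    linarith
  have hL := logTerm_pos hd hℓ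
  have hmin : 0 < min m n := by exact_mod_cast hL.trans_le hmn
  obtain ⟨hm, hn⟩ := lt_min_iff.1 hmin
  have hLm : logTerm d δ ≤ m := hmn.trans (by exact_mod_cast min_le_left m n)
  have hLn : logTerm d δ ≤ n := hmn.trans (by exact_mod_cast min_le_right m n)
  obtain ⟨s, hcard, hs1, hs⟩ := exists_half_net (EuclideanSpace ℝ (Fin d))
  rw [finrank_euclideanSpace_fin] at hcard
  -- `t` pays for d! permutations and `u` for pairs of net points. Since t ≤ 2L and u ≤ 6L with L =
  -- `logTerm d δ` at most m ∧ n, both stay in the Bernstein range.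
  set t := 2 * logTerm d δ with ht
  set u := 4 * (d + Real.log (1 / δ)) with hu
  have hu6 : u ≤ 6 * logTerm d δ := four_mul_le_logTerm hd hℓ
  have hu0 : 0 ≤ u := by positivity
  let BX (M : Matrix (Fin d) (Fin d) ℝ) (t : ℝ) : Set (Fin m → EuclideanSpace ℝ (Fin d)) :=
    {x | 15 * ‖M‖ * √(t / m) < matInner M (sampleCov x - S)}
  let B1 := ⋃ π ∈ (Finset.univ : Finset (Equiv.Perm (Fin d))),
    {z : (Fin m → EuclideanSpace ℝ (Fin d)) × (Fin n → EuclideanSpace ℝ (Fin d)) |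
      z.1 ∈ BX (permute (permute S σ) π⁻¹ - S) t}
  let B2 := ⋃ p ∈ s ×ˢ s,
    {z : (Fin m → EuclideanSpace ℝ (Fin d)) × (Fin n → EuclideanSpace ℝ (Fin d)) |
      z.1 ∈ BX (Matrix.vecMulVec p.2 p.1) u}
  let B3 := ⋃ π ∈ (Finset.univ : Finset (Equiv.Perm (Fin d))),
    {z : (Fin m → EuclideanSpace ℝ (Fin d)) × (Fin n → EuclideanSpace ℝ (Fin d)) |
      15 * ‖permute (sampleCov z.1) π - permute (sampleCov z.1) σ‖ * √(t / n) <
        matInner (permute (sampleCov z.1) π - permute (sampleCov z.1) σ)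
          (sampleCov z.2 - permute S σ)}
  have hB1 : μ.real B1 ≤ δ / 3 := by
    refine (measureReal_biUnion_finset_le _ _).trans
      ((Finset.sum_le_card_nsmul _ _ (Real.exp (-t)) fun π _ ↦ ?_).trans ?_)
    · exact (dataLaw_real_fst_le _ _).trans (measureReal_lt_matInner_sampleCov_sub_le
        hS.posSemidef hS1 _ (by positivity) hm (by linarith))
    · rw [nsmul_eq_mul, Finset.card_univ, Fintype.card_perm, Fintype.card_fin]
      exact factorial_mul_exp_le hd hδ0 hδ1
  have hB2 : μ.real B2 ≤ δ / 3 := by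
    refine (measureReal_biUnion_finset_le _ _).trans
      ((Finset.sum_le_card_nsmul _ _ (Real.exp (-u)) fun p _ ↦ ?_).trans ?_)
    · exact (dataLaw_real_fst_le _ _).trans (measureReal_lt_matInner_sampleCov_sub_le
        hS.posSemidef hS1 _ hu0 hm (by linarith))
    · rw [nsmul_eq_mul, Finset.card_product]
      refine le_trans ?_ (pow_mul_exp_le hd hδ0 hδ1)
      gcongr
      have : s.card * s.card ≤ 25 ^ d := by
        rw [show 25 = 5 * 5 by norm_num, mul_pow]
        exact Nat.mul_le_mul hcard hcard
      exact_mod_cast this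
  have hB3 : μ.real B3 ≤ δ / 3 := by
    refine (measureReal_biUnion_finset_le _ _).trans
      ((Finset.sum_le_card_nsmul _ _ (Real.exp (-t)) fun π _ ↦ ?_).trans ?_)
    · exact dataLaw_real_cross_le hS hS1 σ π (by positivity) hn (by linarith)
    · rw [nsmul_eq_mul, Finset.card_univ, Fintype.card_perm, Fintype.card_fin]
      exact factorial_mul_exp_le hd hδ0 hδ1
  -- Covering the whole space and using subadditivity avoids any measurability claim about `G`.
  have hcover : Set.univ ⊆ G ∪ (B1 ∪ B2 ∪ B3) := by
    intro z _
    by_contra hz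
    simp only [Set.mem_union, not_or, B1, B2, B3, BX, Set.mem_iUnion, Set.mem_ofPred_eq,
      not_exists, not_lt, Finset.mem_univ, true_imp_iff] at hz
    obtain ⟨hzG, ⟨hz1, hz2⟩, hz3⟩ := hz
    refine hzG fun π hπ ↦ hπ.norm_sq_le_rate σ hm hn hL.le hℓ (hz1 π) ?_ (hz3 π)
    refine opNorm_le_of_half_net hs _ (by positivity) fun v hv w hw ↦
      (hz2 (v, w) (Finset.mk_mem_product hv hw)).trans ?_
    rw [norm_vecMulVec]
    have : ‖w‖ * ‖v‖ ≤ 1 := mul_le_one₀ (hs1 w hw) (norm_nonneg _) (hs1 v hv)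
    have h0 : 0 ≤ √(u / m) := Real.sqrt_nonneg _
    nlinarith
  have htot := (measureReal_mono hcover (measure_ne_top μ _)).trans (measureReal_union_le _ _)
  rw [probReal_univ] at htot
  have h12 := measureReal_union_le (μ := μ) B1 B2
  have h123 := measureReal_union_le (μ := μ) (B1 ∪ B2) B3
  linarith
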